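/- For a digraph $D$ on a finite vertex set, the acyclic disconnection $\overrightarrow{\omega}(D)$ is the maximum number of connected components of the underlying graph of $D\setminus A(D^{*})$, taken over all acyclic subdigraphs $D^{*}$ of $D$ (those containing no directed cycle). A partition $\pi$ of $V(D)$ into nonempty classes is externally acyclic if the arcs of $D$ whose ends lie in different classes of $\pi$ form an acyclic digraph; such a partition is optimal if it has exactly $\overrightarrow{\omega}(D)$ classes. A class is singular if it has exactly one element. The digraph $D$ is $\overrightarrow{\omega}$-keen if there is an optimal externally acyclic partition of $V(D)$ with exactly one singular class and no externally acyclic partition of $V(D)$ has more than one singular class. Let $m\ge 1$ and let $J\subseteq\mathbb{Z}_{2m+1}\setminus\{0\}$ satisfy $|J|=m$ and $|\{j,-j\}\cap J|=1$ for every $j\in J$. The circulant tournament $\overrightarrow{C}_{2m+1}(J)$ is the digraph with vertex set $\mathbb{Z}_{2m+1}$ and arc set $\{(i,j): j-i\in J\}$. Theorem. Every circulant tournament $\overrightarrow{C}_{2m+1}(J)$ is $\overrightarrow{\omega}$-keen. -/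

import Mathlib

namespace Digraph

/-- A digraph is acyclic if it contains no directed cycle, that is, if no vertex can be reached
from itself by a directed walk with at least one arc. -/
def HasNoDirectedCycle {V : Type*} (D : Digraph V) : Prop :=
  ∀ v : V, ¬ Relation.TransGen D.Adj v v

/-- The acyclic disconnection of a digraph `D` on a finite vertex set: the maximum number of
connected components of the underlying graph of `D` minus the arcs of `S`, where `S` ranges over
the acyclic subdigraphs of `D`. (The set below contains the value at `S = ⊥` and is bounded by the
number of vertices, so the supremum is a maximum.) -/
noncomputable def acyclicDisconnection {V : Type*} [Fintype V] (D : Digraph V) : ℕ :=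
  sSup {k : ℕ | ∃ S : Digraph V, S ≤ D ∧ S.HasNoDirectedCycle ∧
    k = Nat.card (D \ S).toSimpleGraphInclusive.ConnectedComponent}

variable {V : Type*} [Fintype V] [DecidableEq V]

/-- The subdigraph of the external arcs: those arcs of `D` whose ends lie in different classes
of the partition `P`. -/
def externalArcs (D : Digraph V) (P : Finpartition (Finset.univ : Finset V)) : Digraph V where
  Adj u v := D.Adj u v ∧ P.part u ≠ P.part v

/-- `P` is an externally acyclic partition of the vertex set of `D`. -/
def IsExternallyAcyclic (D : Digraph V) (P : Finpartition (Finset.univ : Finset V)) : Prop :=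
  (D.externalArcs P).HasNoDirectedCycle

/-- `P` is an optimal externally acyclic partition of the vertex set of `D`. -/
def IsOptimalExternallyAcyclic (D : Digraph V) (P : Finpartition (Finset.univ : Finset V)) :
    Prop :=
  D.IsExternallyAcyclic P ∧ P.parts.card = D.acyclicDisconnection

/-- The number of singular classes of a partition, that is, of classes with exactly one element. -/
def numSingularClasses (P : Finpartition (Finset.univ : Finset V)) : ℕ :=
  (P.parts.filter fun s => s.card = 1).card

/-- A digraph is keen for the acyclic disconnection if some optimal externally acyclic partition
has exactly one singular class and no externally acyclic partition has more than one. -/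
def IsOmegaKeen (D : Digraph V) : Prop :=
  (∃ P : Finpartition (Finset.univ : Finset V),
    D.IsOptimalExternallyAcyclic P ∧ numSingularClasses P = 1) ∧
  ∀ P : Finpartition (Finset.univ : Finset V),
    D.IsExternallyAcyclic P → numSingularClasses P ≤ 1

end Digraph

/-- `J` is the symbol set of a circulant tournament of order `2m + 1`. -/
structure IsTournamentSymbolSet (m : ℕ) (J : Finset (ZMod (2 * m + 1))) : Prop where
  zero_notMem : 0 ∉ J
  card_eq : J.card = m
  card_pair_inter : ∀ j ∈ J, (({j, -j} : Finset (ZMod (2 * m + 1))) ∩ J).card = 1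

/-- The digraph with vertex set `ZMod (2m + 1)` and with the arcs `(i, j)` such that `j - i ∈ J`.
It is the circulant tournament with symbol set `J` if `IsTournamentSymbolSet m J` holds. -/
def circulantTournament (m : ℕ) (J : Finset (ZMod (2 * m + 1))) : Digraph (ZMod (2 * m + 1)) where
  Adj i j := j - i ∈ J

/-! An externally acyclic partition amounts to a colouring `c` with a rank `f` that increases along
every arc between different colours.

Uniqueness: if `u → v` are both singular, the ranks force `v` and all its out-neighbours to be
out-neighbours of `u`, against regularity (`singular_unique`).

Existence: `exists_singular` turns an optimal colouring into one with a singular class and no fewer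
colours, by induction on the group. By `exists_coset`, all colours but at most one occur on a single
coset of a proper subgroup `H` such that `J \ H` is a union of `H`-cosets. Recolour `H` by induction
and give one new colour to its complement: each outside vertex dominates all of `H` or is dominated
by all of it.

The subgroup comes from sets with `X + Y ⊆ J` and `|X| + |Y| > |J|`: a Kneser-type bound makes `J`
periodic outside a subgroup (`exists_period`). -/

open Finset
open scoped Pointwise

/-! ### Additive combinatorics: periodic parts of sumsets -/

section Sumset

variable {G : Type*} [AddCommGroup G] [Fintype G] [DecidableEq G]

/-- A sum of two elements lies in a periodic subset of the sumset that is large relative to its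
period (the first half of Kneser's theorem). -/
theorem exists_periodic_subset_add (A B : Finset G) {a b : G} (ha : a ∈ A) (hb : b ∈ B) :
    ∃ (H : AddSubgroup G) (C : Finset G), a + b ∈ C ∧ C ⊆ A + B ∧
      (∀ x ∈ C, ∀ z ∈ H, x + z ∈ C) ∧ #A + #B ≤ #C + Nat.card H := by
  induction hn : #B using Nat.strong_induction_on generalizing A B with
  | _ n ih =>
  -- The Dyson transform at `a' - b` shrinks `B`, keeps `a` and `b`, and preserves `#A + #B`. When
  -- no shift shrinks `B`, the set `B - b` lies in the stabilizer of `A`.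
  by_cases h : ∃ a' ∈ A, ∃ b' ∈ B, a' - b + b' ∉ A
  · obtain ⟨a', ha', b', hb', hab⟩ := h
    have hsub := addDysonETransform.subset (a' - b) (A, B)
    have hcard := addDysonETransform.card (a' - b) (A, B)
    simp only [addDysonETransform_fst, addDysonETransform_snd] at hsub hcard
    have hlt : #(B ∩ (-(a' - b) +ᵥ A)) < n := by
      rw [← hn]
      refine card_lt_card ⟨inter_subset_left, fun hs => hab ?_⟩
      have := (mem_inter.1 (hs hb')).2
      rwa [mem_neg_vadd_finset_iff, vadd_eq_add] at this
    have hb2 : b ∈ B ∩ (-(a' - b) +ᵥ A) := by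
      refine mem_inter.2 ⟨hb, ?_⟩
      rw [mem_neg_vadd_finset_iff, vadd_eq_add, sub_add_cancel]
      exact ha'
    obtain ⟨H, C, h1, h2, h3, h4⟩ := ih _ hlt (A ∪ ((a' - b) +ᵥ B)) _
      (mem_union_left _ ha) hb2 rfl
    exact ⟨H, C, h1, h2.trans hsub, h3, by omega⟩
  · push Not at h
    refine ⟨AddAction.stabilizer G A, A.image (· + b), mem_image_of_mem _ ha, ?_, ?_, ?_⟩
    · rintro _ hx
      obtain ⟨x, hxA, rfl⟩ := mem_image.1 hx
      exact add_mem_add hxA hb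
    · intro x hx z hz
      obtain ⟨y, hy, rfl⟩ := mem_image.1 hx
      rw [AddAction.mem_stabilizer_iff] at hz
      refine mem_image.2 ⟨z +ᵥ y, ?_, by rw [vadd_eq_add]; abel⟩
      rw [← hz]
      exact vadd_mem_vadd_finset hy
    · rw [card_image_of_injective _ (add_left_injective b), ← hn]
      have : #B ≤ Nat.card (AddAction.stabilizer G A) := by
        classical
        rw [Nat.card_eq_fintype_card, ← card_univ]
        have hmem : ∀ b' ∈ B, b' - b ∈ AddAction.stabilizer G A := fun b' hb' => by
          refine AddAction.mem_stabilizer_iff.2 (eq_of_subset_of_card_le ?_ ?_)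
          · intro x hx
            obtain ⟨y, hy, rfl⟩ := mem_vadd_finset.1 hx
            have := h y hy b' hb'
            rwa [vadd_eq_add, show b' - b + y = y - b + b' by abel]
          · rw [card_vadd_finset]
        refine card_le_card_of_injOn (fun b' => if hb' : b' ∈ B then ⟨b' - b, hmem b' hb'⟩ else 0)
          (by simp) fun x hx y hy hxy => ?_
        rw [mem_coe] at hx hy
        simpa [hx, hy] using hxy
      omega

end Sumset

/-! ### Tournament sets and their periods -/

/-- `J` contains exactly one of `x` and `-x` for every nonzero `x`, and it does not contain `0`. -/
structure IsTournamentSet {G : Type*} [AddCommGroup G] (J : Set G) : Prop where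
  zero_notMem : 0 ∉ J
  neg_notMem : ∀ x ∈ J, -x ∉ J
  mem_or_neg_mem : ∀ x, x ≠ 0 → x ∈ J ∨ -x ∈ J

namespace IsTournamentSet

variable {G : Type*} [AddCommGroup G] {J : Set G}

theorem comap (hJ : IsTournamentSet J) (H : AddSubgroup G) :
    IsTournamentSet {x : H | (x : G) ∈ J} where
  zero_notMem := by simpa using hJ.zero_notMem
  neg_notMem x hx := by simpa using hJ.neg_notMem x hx
  mem_or_neg_mem x hx := by simpa using hJ.mem_or_neg_mem (x : G) (by simpa using hx)

/-- The period condition: outside of `H`, the set `J` is a union of cosets of `H`. -/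
def IsPeriodicOutside (J : Set G) (H : AddSubgroup G) : Prop :=
  ∀ x ∈ J, x ∉ H → ∀ z ∈ H, x + z ∈ J

/-- For `x ∈ H \ K` in `J` and `y ∈ K \ H`, adding `y` and then removing `x` stays in `J`, so `y ∈
J`; the same holds for `-y`, a contradiction. -/
theorem le_or_le (hJ : IsTournamentSet J) {H K : AddSubgroup G} (hH : IsPeriodicOutside J H)
    (hK : IsPeriodicOutside J K) : H ≤ K ∨ K ≤ H := by
  by_contra! h
  obtain ⟨⟨x, hxH, hxK⟩, ⟨y, hyK, hyH⟩⟩ :=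
    And.intro (SetLike.not_le_iff_exists.1 h.1) (SetLike.not_le_iff_exists.1 h.2)
  have hx0 : x ≠ 0 := fun h => hxK (h ▸ K.zero_mem)
  have hy0 : y ≠ 0 := fun h => hyH (h ▸ H.zero_mem)
  have key : ∀ x y, x ∈ H → x ∉ K → y ∈ K → y ∉ H → x ∈ J → y ∈ J := by
    intro x y hxH hxK hyK hyH hx
    have h1 := hK x hx hxK y hyK
    have h2 := hH (x + y) h1 (fun h => hyH ((H.add_mem_cancel_left hxH).1 h)) (-x) (H.neg_mem hxH)
    simpa using h2
  have key' : ∀ x, x ∈ H → x ∉ K → x ∉ J := fun x hxH hxK hx =>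
    hJ.neg_notMem y (key x y hxH hxK hyK hyH hx)
      (key x (-y) hxH hxK (K.neg_mem hyK) (by simpa using hyH) hx)
  rcases hJ.mem_or_neg_mem x hx0 with h | h
  · exact key' x hxH hxK h
  · exact key' (-x) (H.neg_mem hxH) (by simpa using hxK) h

variable [Fintype G] [DecidableEq G]

theorem card_eq [DecidablePred (· ∈ J)] (hJ : IsTournamentSet J) :
    Fintype.card G = 2 * #{x | x ∈ J} + 1 := by
  have h1 : #{x : G | -x ∈ J} = #{x : G | x ∈ J} :=
    card_bij (fun x _ => -x) (by simp) (by simp) (fun x hx => ⟨-x, by simpa using hx⟩)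
  have h2 : (univ : Finset G) = insert 0 (({x | x ∈ J} : Finset G) ∪ ({x | -x ∈ J} : Finset G)) := by
    ext x
    have := hJ.mem_or_neg_mem x
    simp only [mem_univ, mem_insert, mem_union, mem_filter, true_and, true_iff]
    tauto
  have h3 : Disjoint ({x | x ∈ J} : Finset G) ({x | -x ∈ J} : Finset G) := by
    rw [Finset.disjoint_left]
    simpa using hJ.neg_notMem
  have h4 := congrArg card h2
  rw [card_univ, card_insert_of_notMem (by simpa using hJ.zero_notMem),
    card_union_of_disjoint h3, h1] at h4
  omega

/-- `C`, `-C` and `H` are pairwise disjoint. An element `x` of `J` outside `C` and `H` would add a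
further disjoint coset `x + H`, too many elements for `G`. Hence `J \ H = C`. -/
theorem isPeriodicOutside_of_large (hJ : IsTournamentSet J) {H : AddSubgroup G} {C : Finset G}
    (hC : ∀ x ∈ C, x ∈ J) (hne : ∀ x ∈ C, ∀ z ∈ H, x + z ∈ C)
    (hcard : Fintype.card G < 2 * (#C + Nat.card H)) :
    IsPeriodicOutside J H ∧ (∀ x ∈ C, x ∉ H) ∧ 2 * #C + Nat.card H ≤ Fintype.card G := by
  classical
  have hCH : ∀ x ∈ C, x ∉ H := fun x hx hxH =>
    hJ.zero_notMem (hC _ (by simpa using hne x hx (-x) (H.neg_mem hxH)))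
  have hH : Nat.card H = #{x : G | x ∈ H} := by
    rw [Nat.card_eq_fintype_card]; exact Fintype.card_subtype _
  have d1 : Disjoint C (-C) := by
    rw [Finset.disjoint_left]
    intro x hx hx'
    exact hJ.neg_notMem x (hC x hx) (hC _ (by simpa using hx'))
  have d2 : Disjoint (C ∪ -C) ({x : G | x ∈ H} : Finset G) := by
    rw [Finset.disjoint_left]
    intro x hx hxH
    simp only [mem_union, mem_neg', mem_filter, mem_univ, true_and] at hx hxH
    rcases hx with hx | hx
    · exact hCH x hx hxH
    · exact hCH _ hx (H.neg_mem hxH)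
  have hU : #((C ∪ -C) ∪ ({x : G | x ∈ H} : Finset G)) = 2 * #C + Nat.card H := by
    rw [card_union_of_disjoint d2, card_union_of_disjoint d1, card_neg, hH]
    ring
  refine ⟨?_, hCH, hU ▸ card_le_univ _⟩
  have hmem : ∀ x ∈ J, x ∉ H → x ∈ C := by
    intro x hx hxH
    by_contra hxC
    have d3 : Disjoint ((C ∪ -C) ∪ ({x : G | x ∈ H} : Finset G))
        (image (x + ·) {x : G | x ∈ H}) := by
      rw [Finset.disjoint_right]
      intro y hy hy'
      simp only [mem_image, mem_filter, mem_univ, true_and] at hy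
      obtain ⟨z, hz, rfl⟩ := hy
      simp only [mem_union, mem_neg', mem_filter, mem_univ, true_and] at hy'
      rcases hy' with (h | h) | h
      · exact hxC (by simpa using hne _ h (-z) (H.neg_mem hz))
      · exact hJ.neg_notMem x hx (hC _ (by simpa using hne _ h z hz))
      · exact hxH ((H.add_mem_cancel_right hz).1 h)
    have := card_le_univ (((C ∪ -C) ∪ ({x : G | x ∈ H} : Finset G)) ∪
        (image (x + ·) {x : G | x ∈ H}))
    rw [card_union_of_disjoint d3, hU, card_image_of_injective _ (add_right_injective x), ← hH]
      at this
    omega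
  exact fun x hx hxH z hz => hC _ (hne x (hmem x hx hxH) z hz)

/-- Two large sets with `X + Y ⊆ J` have a common proper period that avoids `X + Y`. -/
theorem exists_period (hJ : IsTournamentSet J) {X Y : Finset G} (hX : X.Nonempty)
    (hY : Y.Nonempty) (hXY : ∀ x ∈ X, ∀ y ∈ Y, x + y ∈ J)
    (hcard : Fintype.card G < 2 * (#X + #Y)) :
    ∃ H : AddSubgroup G, IsPeriodicOutside J H ∧ (∀ x ∈ X, ∀ y ∈ Y, x + y ∉ H) ∧
      2 * (#X + #Y) ≤ Fintype.card G + Nat.card H := by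
  have key : ∀ x ∈ X, ∀ y ∈ Y, ∃ H : AddSubgroup G, (IsPeriodicOutside J H ∧
      2 * (#X + #Y) ≤ Fintype.card G + Nat.card H) ∧ x + y ∉ H := by
    intro x hx y hy
    obtain ⟨H, C, h1, h2, h3, h4⟩ := exists_periodic_subset_add X Y hx hy
    have hC : ∀ x ∈ C, x ∈ J := by
      intro c hc
      obtain ⟨x', hx', y', hy', rfl⟩ := mem_add.1 (h2 hc)
      exact hXY x' hx' y' hy'
    obtain ⟨h5, h6, h7⟩ := hJ.isPeriodicOutside_of_large hC h3 (by omega)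
    exact ⟨H, ⟨h5, by omega⟩, h6 _ h1⟩
  obtain ⟨x₀, hx₀⟩ := hX
  obtain ⟨y₀, hy₀⟩ := hY
  obtain ⟨H₀, hH₀, -⟩ := key x₀ hx₀ y₀ hy₀
  -- The period from `key` depends on the sum `x + y`; periods form a chain, so a minimal one avoids
  -- every sum.
  obtain ⟨H, hH, hmin⟩ := WellFounded.has_min (wellFounded_lt (α := AddSubgroup G))
    {H | IsPeriodicOutside J H ∧ 2 * (#X + #Y) ≤ Fintype.card G + Nat.card H} ⟨H₀, hH₀⟩
  refine ⟨H, hH.1, fun x hx y hy hxy => ?_, hH.2⟩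
  obtain ⟨K, hK, hxyK⟩ := key x hx y hy
  rcases hJ.le_or_le hH.1 hK.1 with h | h
  · exact hxyK (h hxy)
  · exact hmin K hK (lt_of_le_of_ne h fun h => hxyK (h ▸ hxy))

end IsTournamentSet

/-! ### Concentration of the colours on a coset -/

section Coset

variable {G : Type*} [AddCommGroup G] [Fintype G] {J : Set G}

namespace IsTournamentSet

open Classical in
/-- All classes but one of an externally acyclic colouring of a circulant tournament meet a single
coset of a proper subgroup outside of which `J` is periodic. -/
theorem exists_coset [Nontrivial G] (hJ : IsTournamentSet J) (c f : G → ℕ)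
    (hcf : ∀ u v, v - u ∈ J → c u ≠ c v → f u < f v) :
    ∃ H : AddSubgroup G, IsPeriodicOutside J H ∧ H ≠ ⊤ ∧
      ∃ b, #(univ.image c) ≤ 1 + #(univ.image fun z : H => c (b + z)) := by
  obtain ⟨s, -, hs⟩ := exists_min_image univ f univ_nonempty
  set B : Finset G := {y | c y ≠ c s} with hB
  rcases B.eq_empty_or_nonempty with hBe | hBn
  · refine ⟨⊥, ?_, bot_ne_top, 0, ?_⟩
    · intro x hx _ z hz
      simpa [AddSubgroup.mem_bot.1 hz] using hx
    · refine (card_le_one.2 ?_).trans (Nat.le_add_right _ _)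
      have : ∀ y, c y = c s := by simpa [hB, filter_eq_empty_iff] using hBe
      simp [this]
  obtain ⟨b, hbB, hb⟩ := exists_min_image B f hBn
  have hcb : c b ≠ c s := by simpa [hB] using hbB
  -- `-X` consists of the vertices that dominate all of `B`; `Y` is the largest set with `X + Y ⊆
  -- J`.
  set X : Finset G := {x | ∀ y ∈ B, x + y ∈ J} with hX
  set Y : Finset G := {y | ∀ x ∈ X, x + y ∈ J} with hY
  set D : Finset G := {y ∈ B | b - y ∈ J} with hD
  have hBY : B ⊆ Y := fun y hy => by
    simp only [hY, hX, mem_filter, mem_univ, true_and]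
    exact fun x hx => hx y hy
  have hXY : ∀ x ∈ X, ∀ y ∈ Y, x + y ∈ J := fun x hx y hy => by
    simp only [hY, mem_filter, mem_univ, true_and] at hy
    exact hy x hx
  have hsX : -s ∈ X := by
    simp only [hX, mem_filter, mem_univ, true_and]
    intro y hy
    have hcy : c y ≠ c s := by simpa [hB] using hy
    by_contra hn
    rcases hJ.mem_or_neg_mem (-s + y) (fun h => hcy (by rw [neg_add_eq_zero.1 h])) with h | h
    · exact hn h
    · have := hcf y s (by simpa [neg_add_eq_sub, sub_eq_add_neg] using h) hcy
      exact absurd (hs y (mem_univ _)) (by omega)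
  -- An in-neighbour of `b` outside `B` has the colour of `s` and a rank below `f b`, the least on
  -- `B`, so it dominates all of `B`.
  have hin : ({y | b - y ∈ J} : Finset G) ⊆ D ∪ -X := by
    intro y hy
    simp only [mem_filter, mem_univ, true_and] at hy
    rw [mem_union, mem_neg']
    by_cases hyB : y ∈ B
    · exact Or.inl (by simp [hD, hyB, hy])
    right
    have hcy : c y = c s := by simpa [hB] using hyB
    have h1 := hcf y b hy (by rw [hcy]; exact hcb.symm)
    simp only [hX, mem_filter, mem_univ, true_and]
    intro w hw
    have hcw : c w ≠ c y := by rw [hcy]; simpa [hB] using hw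
    by_contra hn
    rcases hJ.mem_or_neg_mem (-y + w) (fun h => hcw (by rw [neg_add_eq_zero.1 h])) with h | h
    · exact hn h
    · have := hcf w y (by simpa [neg_add_eq_sub, sub_eq_add_neg] using h) hcw
      exact absurd (hb w hw) (by omega)
  have hm : #{x : G | x ∈ J} ≤ #D + #X := by
    have h1 : #{x : G | x ∈ J} = #{y : G | b - y ∈ J} :=
      card_bij (fun x _ => b - x) (by simp) (by simp) (fun x hx => ⟨b - x, by simpa using hx⟩)
    rw [h1, ← card_neg X]
    exact (card_le_card hin).trans (card_union_le _ _)
  have hbD : b ∉ D := by simp [hD, hJ.zero_notMem]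
  have hDB : D ⊆ B := filter_subset _ _
  have hDY : #D + 1 ≤ #Y := by
    rw [← card_insert_of_notMem hbD]
    exact card_le_card ((insert_subset hbB hDB).trans hBY)
  have hn := hJ.card_eq
  obtain ⟨H, hH, hXYH, hcard⟩ := hJ.exists_period ⟨_, hsX⟩ ⟨b, hBY hbB⟩ hXY (by omega)
  refine ⟨H, hH, fun h => hXYH _ hsX _ (hBY hbB) (h ▸ AddSubgroup.mem_top _), b, ?_⟩
  have hper : ∀ z ∈ H, b + z ∈ Y := by
    intro z hz
    simp only [hY, mem_filter, mem_univ, true_and]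
    intro x hx
    rw [← add_assoc]
    exact hH _ (hXY x hx b (hBY hbB)) (hXYH x hx b (hBY hbB)) z hz
  -- The vertices of `b + H` that do not dominate `b`, including `b` itself. The size bounds leave
  -- no room in `Y` beyond `D ∪ Z`.
  set Z : Finset G := image (fun z : H => b + (z : G)) {z : H | -(z : G) ∉ J} with hZ
  have hZcard : 2 * #Z = Nat.card H + 1 := by
    rw [hZ, card_image_of_injective _ fun x y h => by simpa using h]
    have h1 := (hJ.comap H).card_eq
    have h2 := card_filter_add_card_filter_not (s := (univ : Finset H)) (fun z => -(z : G) ∈ J)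
    have h3 : #{z : H | -(z : G) ∈ J} = #{z : H | (z : G) ∈ J} :=
      card_bij (fun x _ => -x) (by simp) (by simp) (fun x hx => ⟨-x, by simpa using hx⟩)
    simp only [Set.mem_ofPred_eq] at h1
    rw [Nat.card_eq_fintype_card]
    rw [card_univ] at h2
    omega
  have hDZ : Disjoint D Z := by
    rw [Finset.disjoint_right]
    intro y hy hyD
    obtain ⟨z, hz, rfl⟩ := mem_image.1 hy
    simp only [mem_filter, mem_univ, true_and] at hz
    exact hz (by simpa using (mem_filter.1 hyD).2)
  have hBD : ∀ y ∈ B, y ∉ D → y - b ∈ H := by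
    intro y hyB hyD
    by_contra hyH
    have hyZ : y ∉ Z := by
      intro hy
      obtain ⟨z, hz, rfl⟩ := mem_image.1 hy
      exact hyH (by simp)
    have h1 : insert y (D ∪ Z) ⊆ Y := by
      refine insert_subset (hBY hyB) (union_subset (hDB.trans hBY) ?_)
      intro w hw
      obtain ⟨z, hz, rfl⟩ := mem_image.1 hw
      exact hper z z.2
    have h2 := card_le_card h1
    rw [card_insert_of_notMem (by simp [hyD, hyZ]), card_union_of_disjoint hDZ] at h2
    omega
  have himg : univ.image c ⊆ insert (c s) (univ.image fun z : H => c (b + z)) := by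
    intro i hi
    obtain ⟨y, -, rfl⟩ := mem_image.1 hi
    rw [mem_insert, or_iff_not_imp_left]
    intro hy
    have hyB : y ∈ B := by simpa [hB] using hy
    by_cases hyD : y ∈ D
    -- A vertex of `D` dominates `b`, so by minimality of `f b` it has the colour of `b`.
    · refine mem_image.2 ⟨0, mem_univ _, ?_⟩
      by_contra hne
      have hlt := hcf y b (mem_filter.1 hyD).2 (by simpa [eq_comm] using hne)
      exact absurd (hb y hyB) (by omega)
    · exact mem_image.2 ⟨⟨y - b, hBD y hyB hyD⟩, mem_univ _, by simp⟩
  refine (card_le_card himg).trans ((card_insert_le _ _).trans (by omega))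

end IsTournamentSet

end Coset

/-! ### Existence and uniqueness of singular colours -/

namespace IsTournamentSet

/-- Every externally acyclic colouring of a circulant tournament can be replaced by one with at
least as many colours and with a colour that occurs exactly once. -/
theorem exists_singular {G : Type*} [AddCommGroup G] [Fintype G] {J : Set G}
    (hJ : IsTournamentSet J) (c f : G → ℕ) (hcf : ∀ u v, v - u ∈ J → c u ≠ c v → f u < f v) :
    ∃ c' f' : G → ℕ, (∀ u v, v - u ∈ J → c' u ≠ c' v → f' u < f' v) ∧
      #(univ.image c) ≤ #(univ.image c') ∧ ∃ v, ∀ u, c' u = c' v → u = v := by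
  classical
  induction hn : Fintype.card G using Nat.strong_induction_on generalizing G with
  | _ n ih =>
  rcases subsingleton_or_nontrivial G with hG | hG
  · exact ⟨c, f, hcf, le_rfl, 0, fun u _ => Subsingleton.elim _ _⟩
  obtain ⟨H, hH, hHtop, b, hcard⟩ := hJ.exists_coset c f hcf
  have hlt : Fintype.card H < n := by
    obtain ⟨x, hx⟩ : ∃ x, x ∉ H := by
      by_contra! h
      exact hHtop ((AddSubgroup.eq_top_iff' H).2 h)
    exact hn ▸ Fintype.card_subtype_lt hx
  obtain ⟨c', f', h1, h2, v, hv⟩ := ih _ hlt (hJ.comap H) (fun z => c (b + z)) (fun z => f (b + z))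
    (fun u w huw hne => hcf _ _ (by simpa using huw) hne) rfl
  obtain ⟨x₀, hx₀⟩ : ∃ x, x ∉ H := by
    by_contra! h
    exact hHtop ((AddSubgroup.eq_top_iff' H).2 h)
  -- The shift frees colour `0` for the complement of `H`. There, out-neighbours of `H` rank above
  -- all of `H`, and in-neighbours rank below.
  refine ⟨fun x => if hx : x ∈ H then c' ⟨x, hx⟩ + 1 else 0,
    fun x => if hx : x ∈ H then f' ⟨x, hx⟩ + 1 else if x ∈ J then univ.sup f' + 2 else 0,
    ?_, ?_, v, ?_⟩
  · intro u w huw hne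
    by_cases hu : u ∈ H <;> by_cases hw : w ∈ H <;> simp only [hu, hw, dite_true, dite_false] at hne ⊢
    · have := h1 ⟨u, hu⟩ ⟨w, hw⟩ (by simpa using huw) (by omega)
      omega
    · have hwJ : w ∈ J := by
        have := hH _ huw (fun h => hw (by simpa using H.add_mem h hu)) u hu
        simpa using this
      have := le_sup (f := f') (mem_univ ⟨u, hu⟩)
      rw [if_pos hwJ]
      omega
    · have huJ : u ∉ J := fun huJ => by
        have := hH _ huw (fun h => hu (by simpa using H.sub_mem hw h)) (-w) (H.neg_mem hw)
        exact hJ.neg_notMem u huJ (by rwa [show w - u + -w = -u by abel] at this)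
      rw [if_neg huJ]
      omega
    · exact absurd rfl hne
  · have hsub : insert 0 ((univ.image c').image (· + 1)) ⊆
        univ.image fun x => if hx : x ∈ H then c' ⟨x, hx⟩ + 1 else 0 := by
      refine insert_subset (mem_image.2 ⟨x₀, mem_univ _, by simp [hx₀]⟩) ?_
      intro i hi
      obtain ⟨j, hj, rfl⟩ := mem_image.1 hi
      obtain ⟨z, -, rfl⟩ := mem_image.1 hj
      exact mem_image.2 ⟨z, mem_univ _, by simp⟩
    have := card_le_card hsub
    rw [card_insert_of_notMem (by simp), card_image_of_injective _ (add_left_injective 1)] at this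
    omega
  · intro u hu
    by_cases huH : u ∈ H
    · simp only [huH, dite_true, v.2] at hu
      exact congrArg Subtype.val (hv ⟨u, huH⟩ (by simpa using hu))
    · simp [huH] at hu

/-- An externally acyclic colouring of a circulant tournament has at most one colour that occurs
exactly once. -/
theorem singular_unique {G κ : Type*} [AddCommGroup G] [Fintype G] {J : Set G}
    (hJ : IsTournamentSet J) (c : G → κ) (f : G → ℕ)
    (hcf : ∀ u v, v - u ∈ J → c u ≠ c v → f u < f v) {u v : G}
    (hu : ∀ w, c w = c u → w = u) (hv : ∀ w, c w = c v → w = v) : u = v := by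
  classical
  by_contra huv
  wlog hJuv : v - u ∈ J generalizing u v
  · refine this hv hu (Ne.symm huv) ?_
    have := (hJ.mem_or_neg_mem (v - u) (sub_ne_zero.2 (Ne.symm huv))).resolve_left hJuv
    simpa using this
  have hlt := hcf u v hJuv fun h => huv (hv u h)
  have hsub : insert v ({w | w - v ∈ J} : Finset G) ⊆ ({w | w - u ∈ J} : Finset G) := by
    refine insert_subset (by simpa using hJuv) fun w hw => ?_
    simp only [mem_filter, mem_univ, true_and] at hw ⊢
    have hwu : w ≠ u := by
      rintro rfl
      exact hJ.neg_notMem _ hw (by simpa using hJuv)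
    have hwv : w ≠ v := by
      rintro rfl
      exact hJ.zero_notMem (by simpa using hw)
    by_contra hn
    have h1 := (hJ.mem_or_neg_mem (w - u) (sub_ne_zero.2 hwu)).resolve_left hn
    have h2 := hcf v w hw fun h => hwv (hv w h.symm)
    have h3 := hcf w u (by simpa using h1) fun h => hwu (hu w h)
    omega
  have hcard : ∀ x : G, #{w : G | w - x ∈ J} = #{w : G | w ∈ J} := fun x =>
    card_bij (fun w _ => w - x) (by simp) (by simp) (fun w hw => ⟨w + x, by simpa using hw⟩)
  have := card_le_card hsub
  rw [card_insert_of_notMem (by simpa using hJ.zero_notMem), hcard, hcard] at this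
  omega

end IsTournamentSet

/-! ### Partitions, colourings and ranks -/

namespace Digraph

theorem not_transGen_of_rank {V : Type*} {r : V → V → Prop} (f : V → ℕ)
    (h : ∀ u v, r u v → f u < f v) (v : V) :
    ¬ Relation.TransGen r v v := by
  have key : ∀ u v, Relation.TransGen r u v → f u < f v := by
    intro u v huv
    induction huv with
    | single h' => exact h _ _ h'
    | tail _ h' ih => exact ih.trans (h _ _ h')
  exact fun hv => lt_irrefl _ (key v v hv)

variable {V : Type*} [Fintype V]

/-- The rank of a vertex counts the vertices that reach it. -/
theorem exists_rank {r : V → V → Prop} (h : ∀ v, ¬ Relation.TransGen r v v) :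
    ∃ f : V → ℕ, ∀ u v, r u v → f u < f v := by
  classical
  refine ⟨fun v => #{u | Relation.TransGen r u v}, fun u v huv => card_lt_card ?_⟩
  refine (ssubset_iff_of_subset fun w hw => ?_).2 ⟨u, ?_, ?_⟩
  · simp only [mem_filter, mem_univ, true_and] at hw ⊢
    exact hw.tail huv
  · simpa using Relation.TransGen.single huv
  · simpa using h u

variable (D : Digraph V)

theorem acyclicDisconnection_bddAbove : BddAbove {k : ℕ | ∃ S : Digraph V, S ≤ D ∧
    S.HasNoDirectedCycle ∧ k = Nat.card (D \ S).toSimpleGraphInclusive.ConnectedComponent} := by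
  refine ⟨Nat.card V, ?_⟩
  rintro _ ⟨S, -, -, rfl⟩
  exact Nat.card_le_card_of_surjective _ Quot.mk_surjective

/-- The acyclic disconnection is attained by an externally acyclic colouring. -/
theorem exists_coloring_acyclicDisconnection : ∃ c f : V → ℕ,
    (∀ u v, D.Adj u v → c u ≠ c v → f u < f v) ∧
      #(univ.image c) = D.acyclicDisconnection := by
  classical
  obtain ⟨S, hSD, hS, hk⟩ := Nat.sSup_mem (s := {k : ℕ | ∃ S : Digraph V, S ≤ D ∧
    S.HasNoDirectedCycle ∧ k = Nat.card (D \ S).toSimpleGraphInclusive.ConnectedComponent})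
    ⟨_, ⊥, bot_le, not_transGen_of_rank (fun _ => 0) (by simp), rfl⟩ D.acyclicDisconnection_bddAbove
  obtain ⟨f, hf⟩ := exists_rank hS
  set Γ := (D \ S).toSimpleGraphInclusive
  have : Finite Γ.ConnectedComponent := Quot.finite _
  let e := Finite.equivFin Γ.ConnectedComponent
  refine ⟨fun v => e (Γ.connectedComponentMk v), f, fun u v huv hne => hf u v ?_, ?_⟩
  -- An arc outside `S` would join the two components.
  · by_contra hSuv
    refine hne (congrArg (fun x => (e x : ℕ)) (SimpleGraph.ConnectedComponent.sound ?_))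
    refine SimpleGraph.Adj.reachable ?_
    refine (SimpleGraph.fromRel_adj _ _ _).2 ⟨?_, Or.inl ⟨huv, hSuv⟩⟩
    rintro rfl
    exact hne rfl
  · have himg : (univ.image fun v => (e (Γ.connectedComponentMk v) : ℕ)) =
        range (Nat.card Γ.ConnectedComponent) := by
      ext i
      simp only [mem_image, mem_univ, true_and, mem_range]
      constructor
      · rintro ⟨v, rfl⟩
        exact (e _).2
      · intro hi
        obtain ⟨v, hv⟩ := Quot.mk_surjective (e.symm ⟨i, hi⟩)
        refine ⟨v, ?_⟩
        change ((e (Quot.mk _ v) : Fin _) : ℕ) = i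
        rw [hv]
        simp
    rw [himg, card_range]
    exact hk.symm

variable [DecidableEq V]

/-- Without the external arcs, each component lies in one class, so the components map onto the
classes. -/
theorem card_parts_le_acyclicDisconnection (P : Finpartition (univ : Finset V))
    (hP : D.IsExternallyAcyclic P) : #P.parts ≤ D.acyclicDisconnection := by
  classical
  refine le_trans ?_ (le_csSup D.acyclicDisconnection_bddAbove
    ⟨D.externalArcs P, fun u v h => h.1, hP, rfl⟩)
  set Γ := (D \ D.externalArcs P).toSimpleGraphInclusive
  have : Finite Γ.ConnectedComponent := Quot.finite _
  have hadj : ∀ u v, Γ.Adj u v → P.part u = P.part v := by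
    intro u v huv
    by_contra hne
    rcases ((SimpleGraph.fromRel_adj _ _ _).1 huv).2 with h | h
    · exact h.2 ⟨h.1, hne⟩
    · exact h.2 ⟨h.1, Ne.symm hne⟩
  have hreach : ∀ u v, Γ.Reachable u v → P.part u = P.part v := by
    rintro u v ⟨p⟩
    induction p with
    | nil => rfl
    | cons h _ ih => exact (hadj _ _ h).trans ih
  let F : Γ.ConnectedComponent → P.parts := Quot.lift
    (fun v => ⟨P.part v, P.part_mem.2 (mem_univ v)⟩) fun u v h => Subtype.ext (hreach u v h)
  have hF : Function.Surjective F := by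
    rintro ⟨s, hs⟩
    obtain ⟨v, hv⟩ := P.nonempty_of_mem_parts hs
    exact ⟨Quot.mk _ v, Subtype.ext (P.part_eq_of_mem hs hv)⟩
  have := Nat.card_le_card_of_surjective F hF
  rwa [Nat.card_eq_fintype_card, Fintype.card_coe] at this

/-- The partition into the classes of a colouring. -/
theorem exists_finpartition {κ : Type*} [DecidableEq κ] (c : V → κ) :
    ∃ P : Finpartition (univ : Finset V), #P.parts = #(univ.image c) ∧
      ∀ u v, u ∈ P.part v ↔ c u = c v := by
  let P := Finpartition.ofSetoid (Setoid.ker c)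
  have hP : ∀ u v, u ∈ P.part v ↔ c u = c v := fun u v => by
    rw [Finpartition.mem_part_ofSetoid_iff_rel, eq_comm]
    exact Setoid.ker_def
  refine ⟨P, ?_, hP⟩
  symm
  refine card_bij (fun i hi => P.part (mem_image.1 hi).choose) (fun i hi => ?_) ?_ ?_
  · exact P.part_mem.2 (mem_univ _)
  · intro i hi j hj hij
    rw [← (mem_image.1 hi).choose_spec.2, ← (mem_image.1 hj).choose_spec.2, ← hP]
    rw [← hij]
    exact P.mem_part (mem_univ _)
  · intro s hs
    obtain ⟨v, hv⟩ := P.nonempty_of_mem_parts hs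
    have hi : c v ∈ univ.image c := mem_image_of_mem c (mem_univ v)
    refine ⟨c v, hi, P.part_eq_of_mem hs ?_⟩
    rw [← P.part_eq_of_mem hs hv, hP]
    exact (mem_image.1 hi).choose_spec.2

end Digraph

theorem IsTournamentSymbolSet.isTournamentSet {m : ℕ} {J : Finset (ZMod (2 * m + 1))}
    (hJ : IsTournamentSymbolSet m J) : IsTournamentSet (J : Set (ZMod (2 * m + 1))) := by
  have h0 : (0 : ZMod (2 * m + 1)) ∉ J := hJ.zero_notMem
  have hneg : ∀ x ∈ J, -x ∉ J := by
    intro x hx hnx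
    have h1 := hJ.card_pair_inter x hx
    have h2 : ({x, -x} : Finset (ZMod (2 * m + 1))) ∩ J = {x, -x} :=
      inter_eq_left.2 (insert_subset hx (singleton_subset_iff.2 hnx))
    have hxx : x = -x := by
      by_contra hne
      rw [h2, card_pair hne] at h1
      omega
    have hx0 : x = 0 := by
      have h3 : (2 : ZMod (2 * m + 1)) * x = 0 := by linear_combination hxx
      have h4 : ((2 * m + 1 : ℕ) : ZMod (2 * m + 1)) = 0 := ZMod.natCast_self _
      push_cast at h4
      -- Odd order rules out 2-torsion: `x = (2m + 1)x - m(2x)`.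
      linear_combination x * h4 - m * h3
    exact h0 (hx0 ▸ hx)
  have hd : Disjoint J (-J) := by
    rw [Finset.disjoint_left]
    exact fun x hx hx' => hneg x hx (by simpa using hx')
  have huniv : insert 0 (J ∪ -J) = univ := by
    refine eq_univ_of_card _ ?_
    rw [card_insert_of_notMem (by simpa using h0), card_union_of_disjoint hd, card_neg, hJ.card_eq,
      ZMod.card]
    ring
  refine ⟨by simpa using h0, by simpa using hneg, fun x hx => ?_⟩
  have := mem_univ x
  rw [← huniv] at this
  simpa [hx] using this

theorem mainTheorem3 (m : ℕ) (hm : 1 ≤ m) (J : Finset (ZMod (2 * m + 1)))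
    (hJ : IsTournamentSymbolSet m J) :
    (circulantTournament m J).IsOmegaKeen := by
  have hT := hJ.isTournamentSet
  have hle : ∀ P : Finpartition (univ : Finset (ZMod (2 * m + 1))),
      (circulantTournament m J).IsExternallyAcyclic P → Digraph.numSingularClasses P ≤ 1 := by
    intro P hP
    obtain ⟨f, hf⟩ := Digraph.exists_rank hP
    refine card_le_one.2 fun s hs t ht => ?_
    obtain ⟨hsP, hs1⟩ := mem_filter.1 hs
    obtain ⟨htP, ht1⟩ := mem_filter.1 ht
    obtain ⟨u, rfl⟩ := card_eq_one.1 hs1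
    obtain ⟨v, rfl⟩ := card_eq_one.1 ht1
    have key : ∀ u : ZMod (2 * m + 1), {u} ∈ P.parts → ∀ w, P.part w = P.part u → w = u := by
      intro u hu w hw
      rw [P.part_eq_of_mem hu (mem_singleton_self u)] at hw
      exact mem_singleton.1 (hw ▸ P.mem_part (mem_univ w))
    rw [hT.singular_unique P.part f (fun u v huv hne => hf u v ⟨huv, hne⟩) (key u hsP) (key v htP)]
  refine ⟨?_, hle⟩
  obtain ⟨c, f, hcf, hc⟩ := (circulantTournament m J).exists_coloring_acyclicDisconnection
  obtain ⟨c', f', hcf', hcard, v, hv⟩ := hT.exists_singular c f hcf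
  obtain ⟨P, hPcard, hP⟩ := Digraph.exists_finpartition c'
  have hPa : (circulantTournament m J).IsExternallyAcyclic P := by
    refine Digraph.not_transGen_of_rank f' fun u w huw => hcf' u w huw.1 fun h => huw.2 ?_
    exact P.part_eq_of_mem (P.part_mem.2 (mem_univ w)) ((hP u w).2 h)
  refine ⟨P, ⟨hPa, le_antisymm (Digraph.card_parts_le_acyclicDisconnection _ P hPa) (by omega)⟩,
    le_antisymm (hle P hPa) (card_pos.2 ⟨P.part v, ?_⟩)⟩
  refine mem_filter.2 ⟨P.part_mem.2 (mem_univ v), card_eq_one.2 ⟨v, ?_⟩⟩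
  ext u
  rw [hP, mem_singleton]
  exact ⟨hv u, fun h => by rw [h]⟩
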